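/- Let $v$ be an indeterminate and let $n$ be odd. Fix the symmetric bilinear form on $\mathbb F_q^{2d+1}$ ($q$ odd) with antidiagonal Gram matrix. An $n$-step partial isotropic flag is a chain $0=V_0\subseteq V_1\subseteq\dots\subseteq V_n=\mathbb F_q^{2d+1}$ with $V_{n-i}=V_i^\perp$. Pairs $(V,V')$ of such flags are classified by their relative position $A=(a_{ij})\in\Xi_d$, where $\dim(V_i\cap V'_j)=\sum_{k\le i,\,l\le j}a_{kl}$ and $\Xi_d$ is the set of $n\times n$ matrices over $\mathbb N$ with $a_{ij}=a_{n+1-i,n+1-j}$ and entry sum $2d+1$. Let $\mathcal O_A$ be the set of pairs in position $A$. Let $\mathbf S^\jmath(n,d)$ be the generic convolution algebra of these pairs over $\mathbb Q(v)$: it has basis $(e_A)_{A\in\Xi_d}$ and product $e_A*e_B=\sum_C g_{A,B}^C(v^2)\,e_C$, where $g^C_{A,B}\in\mathbb Z[X]$ is the polynomial such that for every odd prime power $q$ and every $(V,V')\in\mathcal O_C$ the number of flags $W$ with $(V,W)\in\mathcal O_A$ and $(W,V')\in\mathcal O_B$ is $g^C_{A,B}(q)$. Put $[A]=v^{-\delta(A)}e_A$,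 where $$\delta(A)=\tfrac12\Big(\sum_{i\ge k,\;j<l}a_{ij}a_{kl}-\sum_{i\ge (n+1)/2>j}a_{ij}\Big)$$ is the dimension of the fibre of $\mathcal O_A$ over the first flag. For $a,r\in\mathbb N$ with $a+r=d$ put $A_{a,r}=\begin{pmatrix}a&0&r\\0&1&0\\r&0&a\end{pmatrix}$. Let $\mathbf S^\imath(2,d)\subseteq\mathbf S^\jmath(3,d)$ be the $\mathbb Q(v)$-span of the elements $[A_{a,r}]$, $a+r=d$, and let $M_{a,r}=[X]*[Y]$ with $$X=\begin{pmatrix}a&r&0\\0&1&0\\0&r&a\end{pmatrix},\qquad Y=\begin{pmatrix}a&0&0\\r&1&r\\0&0&a\end{pmatrix}.$$ **Theorem.** Let $d\in\mathbb N$. (1) For all $a+r=d$ the element $M_{a,r}$ lies in $\mathbf S^\imath(2,d)$, and there is exactly one involution $\overline{\phantom{x}}$ of $\mathbf S^\imath(2,d)$ (the bar involution) that is semilinear with respect to $v\mapsto v^{-1}$ and fixes $M_{a,r}$ for all $a+r=d$. (2) Every ring involution of $\mathbf S^\jmath(3,d)$ that is semilinear with respect to $v\mapsto v^{-1}$ and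 fixes the divided power generators restricts to it on $\mathbf S^\imath(2,d)$. Here the divided power generators are the $[A]$ with $A\in\Xi_d$ such that $A$ is diagonal or $A-R\,E^\theta_{h,h+1}$ is diagonal for some $R\in\mathbb N$ and $h\in\{1,2\}$, where $E^\theta_{ij}$ has $(k,l)$-entry $\delta_{ki}\delta_{lj}+\delta_{k,4-i}\delta_{l,4-j}$. (3) For all $a,r\in\mathbb N$ with $a+r=d$, $$\overline{[A_{a,r}]}=\sum_{i=0}^r v^{-ia-\binom{i+1}2}\,\frac{\prod_{k=1}^i(1-v^{2(a+k)})}{\prod_{k=1}^{\lfloor i/2\rfloor}(1-v^{4k})}\,[A_{a+i,r-i}] =\sum_{i=0}^r\frac{\prod_{k=1}^i(v^{-a-k}-v^{a+k})}{\prod_{k=1}^{\lfloor i/2\rfloor}(1-v^{4k})}\,[A_{a+i,r-i}].$$ -/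

import Mathlib

noncomputable section

open scoped BigOperators

/-- The ground field `ℚ(v)`. -/
abbrev Qv : Type := RatFunc ℚ

/-- The indeterminate `v`. -/
def vv : Qv := RatFunc.X

theorem transcendental_vv_inv : Transcendental ℚ (vv⁻¹) := by
  intro h
  exact RatFunc.transcendental_X (K := ℚ) (by
    have h2 := h.inv
    rw [inv_inv] at h2
    convert h2 using 1
    · exact Subsingleton.elim _ _
    · rfl)

/-- The field homomorphism `ℚ(v) → ℚ(v)` over `ℚ` with `v ↦ v⁻¹`. -/
def conjQv : Qv →+* Qv :=
  RatFunc.liftRingHom (Polynomial.aeval (vv⁻¹ : Qv) : Polynomial ℚ →ₐ[ℚ] Qv).toRingHom (by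
    intro p hp
    rw [Submonoid.mem_comap, mem_nonZeroDivisors_iff_ne_zero]
    intro h0
    exact nonZeroDivisors.ne_zero hp
      ((transcendental_iff.mp transcendental_vv_inv) p h0))

theorem conjQv_vv : conjQv vv = vv⁻¹ := by
  simp [conjQv, vv]

/-! ### Partial isotropic flags over finite fields -/

/-- The symmetric bilinear form on `F^{2d+1}` with antidiagonal Gram matrix. It is nondegenerate;
over a field of odd order every nondegenerate symmetric form in odd dimension is, up to a nonzero
scalar, isometric to it. -/
def quadForm (F : Type) [Field F] (d : ℕ) : LinearMap.BilinForm F (Fin (2 * d + 1) → F) :=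
  Matrix.toBilin' (Matrix.of fun i j => if j = i.rev then (1 : F) else 0)

/-- `n`-step partial isotropic flags in `F^{2d+1}`:
`0 = V_0 ⊆ V_1 ⊆ … ⊆ V_n = F^{2d+1}` with `V_{n-i} = V_i^⊥`. -/
structure IsoFlag (F : Type) [Field F] (n d : ℕ) where
  space : Fin (n + 1) → Submodule F (Fin (2 * d + 1) → F)
  mono : Monotone space
  bot : space 0 = ⊥
  top : space (Fin.last n) = ⊤
  orth : ∀ i, space i.rev = (quadForm F d).orthogonal (space i)

/-- The index set `Ξ_d`: centrally symmetric `n × n` matrices over `ℕ` with entry sum `2d+1`. -/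
def XiSet (n d : ℕ) : Set (Matrix (Fin n) (Fin n) ℕ) :=
  {A | (∑ i, ∑ j, A i j = 2 * d + 1) ∧ ∀ i j, A i j = A i.rev j.rev}

theorem XiSet_finite (n d : ℕ) : (XiSet n d).Finite := by
  apply Set.Finite.subset
    (Set.Finite.pi' (fun _ : Fin n => Set.Finite.pi' (fun _ : Fin n => Set.finite_Iic (2 * d + 1))))
  intro A hA i j
  rw [Set.mem_Iic, ← hA.1]
  exact (Finset.single_le_sum (f := fun l => A i l) (fun _ _ => Nat.zero_le _)
    (Finset.mem_univ j)).trans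
    (Finset.single_le_sum (f := fun k => ∑ l, A k l) (fun _ _ => Nat.zero_le _)
    (Finset.mem_univ i))

abbrev Xi (n d : ℕ) : Type := {A : Matrix (Fin n) (Fin n) ℕ // A ∈ XiSet n d}

instance (n d : ℕ) : Fintype (Xi n d) := (XiSet_finite n d).fintype

/-- The pair `(V, V')` of flags lies in the orbit `O_A`, that is
`a_{ij} = dim (V_{i-1} + V_i ∩ V'_j) / (V_{i-1} + V_i ∩ V'_{j-1})` for all `i, j`; equivalently
`dim (V_i ∩ V'_j) = ∑_{k ≤ i, l ≤ j} a_{kl}` for `0 ≤ i, j ≤ n`. (The matrix is indexed from `0`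
here, so that `k ≤ i` reads `k < i`.) -/
def RelPos {F : Type} [Field F] {n d : ℕ} (A : Matrix (Fin n) (Fin n) ℕ)
    (V V' : IsoFlag F n d) : Prop :=
  ∀ i j : Fin (n + 1),
    Module.finrank F (V.space i ⊓ V'.space j : Submodule F (Fin (2 * d + 1) → F)) =
      ∑ k : Fin n, ∑ l : Fin n, if k.val < i.val ∧ l.val < j.val then A k l else 0

/-- `p` is the generic structure constant: over every finite field of odd order `q`, the coefficient
of `e_C` in the convolution product `e_A * e_B` equals `p(q)`. -/
def IsStructPoly {n d : ℕ} (A B C : Xi n d) (p : Polynomial ℤ) : Prop :=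
  ∀ (F : Type) [Field F] [Fintype F], Odd (Fintype.card F) →
    ∀ V V' : IsoFlag F n d, RelPos C.1 V V' →
      p.eval (Fintype.card F : ℤ) =
        (Nat.card {W : IsoFlag F n d // RelPos A.1 V W ∧ RelPos B.1 W V'} : ℤ)

open Classical in
/-- The polynomial of `IsStructPoly` (which exists and is unique). -/
def structPoly {n d : ℕ} (A B C : Xi n d) : Polynomial ℤ :=
  if h : ∃! p : Polynomial ℤ, IsStructPoly A B C p then h.choose else 0

/-! ### The Schur algebras -/

/-- The `ȷ`Schur algebra `S^ȷ(n,d)` over `ℚ(v)`: the generic convolution algebra of pairs of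
`n`-step partial isotropic flags. An element is the family of its coefficients with respect to the
characteristic functions `e_A` of the orbits, `A ∈ Ξ_d`; here `q = v²`. -/
def JSchur (n d : ℕ) : Type := Xi n d → Qv

instance (n d : ℕ) : AddCommGroup (JSchur n d) := inferInstanceAs (AddCommGroup (Xi n d → Qv))

instance (n d : ℕ) : Module Qv (JSchur n d) := inferInstanceAs (Module Qv (Xi n d → Qv))

/-- The convolution product, the bilinear extension of `e_A * e_B = ∑_C g_{A,B}^C(v²) e_C`. -/
instance (n d : ℕ) : Mul (JSchur n d) :=
  ⟨fun x y C => ∑ A : Xi n d, ∑ B : Xi n d,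
    x A * y B * Polynomial.aeval (vv ^ 2) (structPoly A B C)⟩

/-- The dimension of the fibre of `O_A` over its first flag,
`½ (∑_{i ≥ k, j < l} a_{ij} a_{kl} - ∑_{i ≥ m > j} a_{ij})`, where `m` is the middle index
(`2m = n + 1`, which for indices `i` from `0` reads `n ≤ 2i + 1`). -/
def fibreDim {n : ℕ} (A : Matrix (Fin n) (Fin n) ℕ) : ℕ :=
  ((∑ i : Fin n, ∑ j : Fin n, ∑ k : Fin n, ∑ l : Fin n,
      if k ≤ i ∧ j < l then A i j * A k l else 0) -
    ∑ i : Fin n, ∑ j : Fin n,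
      if n ≤ 2 * i.val + 1 ∧ 2 * j.val + 1 < n then A i j else 0) / 2

open Classical in
/-- The standard basis element `[A] = v^{-(dim O_A - dim r(O_A))} e_A`, where `r` is the projection
to the first flag, and `[A] = 0` if `A ∉ Ξ_d`. -/
def std {n : ℕ} (d : ℕ) (A : Matrix (Fin n) (Fin n) ℕ) : JSchur n d :=
  fun B => if B.1 = A then vv ^ (-(fibreDim A : ℤ)) else 0

/-- `E^θ_{ij}`. -/
def Etheta {n : ℕ} (i j : Fin n) : Matrix (Fin n) (Fin n) ℕ :=
  fun k l => (if k = i ∧ l = j then 1 else 0) + (if k = i.rev ∧ l = j.rev then 1 else 0)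

/-- The matrices that index the divided power generators of `S^ȷ(n,d)`: diagonal ones, and those
for which `A - R E^θ_{h,h+1}` is diagonal for some `h` and `R`. Note that
`E^θ_{h+1,h} = E^θ_{n-h,n+1-h}`. -/
def IsChevalley {n : ℕ} (A : Matrix (Fin n) (Fin n) ℕ) : Prop :=
  A.IsDiag ∨ ∃ (h h' : Fin n) (R : ℕ) (D : Fin n → ℕ),
    h'.val = h.val + 1 ∧
      ∀ k l, A k l = (if k = l then D k else 0) + R * Etheta h h' k l

/-- The bar involution of the algebra `S^ȷ(n,d)`: the ring involution that is semilinear for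
`v ↦ v⁻¹` and fixes the divided power generators. -/
structure IsJBar (n d : ℕ) (β : JSchur n d →ₛₗ[conjQv] JSchur n d) : Prop where
  map_mul : ∀ x y, β (x * y) = β x * β y
  invol : ∀ x, β (β x) = x
  fixes : ∀ A : Matrix (Fin n) (Fin n) ℕ, A ∈ XiSet n d → IsChevalley A → β (std d A) = std d A

/-- The index set `Ξ^ı_d ⊆ Ξ_d`: the middle row and the middle column are those of the identity. -/
def XiISet (n d : ℕ) : Set (Matrix (Fin n) (Fin n) ℕ) :=
  {A | A ∈ XiSet n d ∧ ∀ m : Fin n, m.rev = m →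
    ∀ j, A m j = (if j = m then 1 else 0) ∧ A j m = (if j = m then 1 else 0)}

/-- The `ı`Schur algebra `S^ı(𝔫,d)`, `𝔫` even, inside `S^ȷ(𝔫+1,d)`. -/
def ISchur (k d : ℕ) : Submodule Qv (JSchur (k + 1) d) :=
  Submodule.span Qv {x | ∃ A ∈ XiISet (k + 1) d, x = std d A}

/-! ### Rank one -/

def Amat (a b : ℕ) : Matrix (Fin 3) (Fin 3) ℕ := !![a, 0, b; 0, 1, 0; b, 0, a]

theorem Amat_mem (a b : ℕ) : Amat a b ∈ XiISet 3 (a + b) := by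
  refine ⟨⟨?_, ?_⟩, ?_⟩
  · simp [Amat, Fin.sum_univ_three]; ring
  · intro i j; fin_cases i <;> fin_cases j <;> rfl
  · intro m hm j
    fin_cases m <;> first | (exfalso; revert hm; decide) | (fin_cases j <;> simp [Amat])

/-- `[A_{a,b}]` as an element of `S^ı(2,d)`, `a + b = d`. -/
def stdA (d a b : ℕ) (h : a + b = d) : ISchur 2 d :=
  ⟨std d (Amat a b), Submodule.subset_span ⟨Amat a b, h ▸ Amat_mem a b, rfl⟩⟩

/-- The monomial `M_{a,r} = [X] * [Y]`, with `X - r E^θ_{1,2}` and `Y - r E^θ_{2,1}` diagonal. -/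
def monoM (d a r : ℕ) : JSchur 3 d :=
  std d !![a, r, 0; 0, 1, 0; 0, r, a] * std d !![a, 0, 0; r, 1, r; 0, 0, a]

/-- The bar involution of `S^ı(2,d)`: the involution that is semilinear for `v ↦ v⁻¹` and fixes the
monomials `M_{a,r} ∈ S^ı(2,d)`, `a + r = d`. -/
structure IsIBar (d : ℕ) (β : ISchur 2 d →ₛₗ[conjQv] ISchur 2 d) : Prop where
  invol : ∀ x, β (β x) = x
  fixes : ∀ a r : ℕ, a + r = d → ∃ m : ISchur 2 d, (m : JSchur 3 d) = monoM d a r ∧ β m = m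

end

/-! The monomials `M_{a,r}` are computed explicitly, and everything follows from their expansion in
the standard basis. Over a finite field, a flag `W` contributing to the product `[X] * [Y]` at `(V,
V')` exists only if `V_1` and `V'_1` are both maximal isotropic. It then amounts to an
`a`-dimensional subspace of `V_1 ∩ V'_1`. So only the `A_{c,s}` occur, with Gaussian binomials as
structure constants. After normalisation `M_{a,r} = ∑_j monoCoeff a j • [A_{a+j,r-j}]`
(`monoM_eq_sum`), with leading coefficient `1`.

By unitriangularity the monomials span `S^ı(2,d)` (`span_monoI`), so a semilinear map fixing them is
unique and is an involution. A bar involution of `S^ȷ(3,d)` fixes `X` and `Y`, hence their product,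
and must restrict to this map.

For existence and formula (3) together, `barI` is defined by the asserted formula on the standard
basis. That it fixes the monomials is the identity `∑_j conj(monoCoeff a j) · barCoeff (a+j) (n-j) =
monoCoeff a n` (`sum_conjQv_monoCoeff_mul_barCoeff`). With `q = v²`, cancelling Pochhammer symbols
turns it into the `q`-series identity `sum_qPoch_inv`, the coefficientwise form of `(-qx;q)_∞ ·
(1+x)/(x²;q²)_∞ = 1/(x;q)_∞`. -/

noncomputable section

open scoped BigOperators

/-! ### Gaussian binomials and `q`-Pochhammer symbols. -/

open Polynomial in
/-- The Gaussian binomial coefficients as integer polynomials. -/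
def gaussBinom : ℕ → ℕ → Polynomial ℤ
  | _, 0 => 1
  | 0, _ + 1 => 0
  | n + 1, k + 1 => gaussBinom n k + X ^ (k + 1) * gaussBinom n (k + 1)

/-- The `q`-Pochhammer symbol `(q; q)_n`. -/
def qPoch {R : Type*} [CommRing R] (q : R) (n : ℕ) : R :=
  ∏ k ∈ Finset.range n, (1 - q ^ (k + 1))

section qPoch

variable {R S : Type*} [CommRing R] [CommRing S]

@[simp] theorem qPoch_zero (q : R) : qPoch q 0 = 1 := by simp [qPoch]

theorem qPoch_succ (q : R) (n : ℕ) : qPoch q (n + 1) = qPoch q n * (1 - q ^ (n + 1)) :=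
  Finset.prod_range_succ _ _

theorem map_qPoch (f : R →+* S) (q : R) (n : ℕ) : f (qPoch q n) = qPoch (f q) n := by
  simp [qPoch, map_prod]

theorem qPoch_ne_zero [IsDomain R] {q : R} (hq : ∀ n : ℕ, q ^ (n + 1) ≠ 1) (n : ℕ) :
    qPoch q n ≠ 0 :=
  Finset.prod_ne_zero_iff.mpr fun k _ => sub_ne_zero.mpr (hq k).symm

theorem qPoch_inv {K : Type*} [Field K] {q : K} (hq : q ≠ 0) (n : ℕ) :
    qPoch q⁻¹ n = (-1) ^ n * (q ^ ((n + 1).choose 2))⁻¹ * qPoch q n := by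
  induction n with
  | zero => simp
  | succ n ih =>
    rw [qPoch_succ, qPoch_succ, ih, Nat.choose_succ_succ' (n + 1) 1, Nat.choose_one_right]
    have e : 1 - q⁻¹ ^ (n + 1) = -(q ^ (n + 1))⁻¹ * (1 - q ^ (n + 1)) := by
      rw [inv_pow]
      have := pow_ne_zero (n + 1) hq
      field_simp
      ring
    rw [e, show 1 + 1 = 2 from rfl, pow_add q (n + 1), mul_inv, pow_succ (-1 : K)]
    ring

end qPoch

theorem gaussBinom_zero_right (n : ℕ) : gaussBinom n 0 = 1 := by
  cases n <;> rfl

theorem gaussBinom_eq_zero {n k : ℕ} (h : n < k) : gaussBinom n k = 0 := by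
  induction n generalizing k with
  | zero =>
    obtain ⟨k, rfl⟩ := Nat.exists_eq_succ_of_ne_zero h.ne'
    rfl
  | succ n ih =>
    obtain ⟨k, rfl⟩ := Nat.exists_eq_succ_of_ne_zero (Nat.ne_of_gt (Nat.zero_lt_of_lt h))
    rw [Nat.succ_eq_add_one, gaussBinom, ih (by omega), ih (by omega)]
    simp

theorem gaussBinom_self (n : ℕ) : gaussBinom n n = 1 := by
  induction n with
  | zero => rfl
  | succ n ih => rw [gaussBinom, ih, gaussBinom_eq_zero (Nat.lt_succ_self n)]; simp

-- Being free of division, this form can be evaluated both at `q = |F|` in `ℤ` and at `q = v²`. The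
-- double induction on `a` and `j` follows the `q`-Pascal rule.
open Polynomial in
theorem gaussBinom_mul_qPoch (a j : ℕ) :
    gaussBinom (a + j) a * (qPoch X a * qPoch X j) = qPoch (X : ℤ[X]) (a + j) := by
  induction a generalizing j with
  | zero => simp [gaussBinom_zero_right]
  | succ a iha =>
    induction j with
    | zero => simp [gaussBinom_self]
    | succ j ihj =>
      have h1 := iha (j + 1)
      have e1 : a + 1 + (j + 1) = a + (j + 1) + 1 := by omega
      have e2 : a + 1 + j = a + (j + 1) := by omega
      rw [e2] at ihj
      rw [e1, gaussBinom, qPoch_succ X (a + (j + 1))]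
      rw [qPoch_succ X a] at ihj ⊢
      rw [qPoch_succ X j] at h1 ⊢
      linear_combination (1 - X ^ (a + 1)) * h1 + X ^ (a + 1) * (1 - X ^ (j + 1)) * ihj

theorem aeval_gaussBinom_mul_qPoch {R : Type*} [CommRing R] [Algebra ℤ R] (q : R) (a j : ℕ) :
    Polynomial.aeval q (gaussBinom (a + j) a) * (qPoch q a * qPoch q j) = qPoch q (a + j) := by
  have h := congrArg (Polynomial.aeval q).toRingHom (gaussBinom_mul_qPoch a j)
  rw [map_mul, map_mul, map_qPoch, map_qPoch, map_qPoch] at h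
  simpa using h

theorem two_mul_choose_succ_two (n : ℕ) : 2 * (((n + 1).choose 2 : ℕ) : ℤ) = n * (n + 1) := by
  have : (n + 1).choose 2 * 2 = (n + 1) * n := by
    rw [Nat.choose_two_right, Nat.add_sub_cancel,
      Nat.div_mul_cancel (by rw [mul_comm]; exact (Nat.even_mul_succ_self n).two_dvd)]
  zify at this
  linarith

/-- Each Pochhammer symbol is inverted separately. The signs cancel and the exponents leave
`binom(a+j+1,2) - binom(a+1,2) - binom(j+1,2) = aj`. -/
theorem aeval_gaussBinom_inv {K : Type*} [Field K] [Algebra ℤ K] {q : K} (hq0 : q ≠ 0)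
    (hq : ∀ n : ℕ, q ^ (n + 1) ≠ 1) (a j : ℕ) :
    Polynomial.aeval q⁻¹ (gaussBinom (a + j) a) =
      (q ^ (a * j))⁻¹ * Polynomial.aeval q (gaussBinom (a + j) a) := by
  have h1 := aeval_gaussBinom_mul_qPoch q a j
  have h2 := aeval_gaussBinom_mul_qPoch q⁻¹ a j
  have ha := qPoch_ne_zero hq a
  have hj := qPoch_ne_zero hq j
  rw [qPoch_inv hq0, qPoch_inv hq0, qPoch_inv hq0, ← h1] at h2
  have e : (a + j + 1).choose 2 = (a + 1).choose 2 + (j + 1).choose 2 + a * j := by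
    have t := two_mul_choose_succ_two (a + j)
    zify
    push_cast at t
    linarith [two_mul_choose_succ_two a, two_mul_choose_succ_two j]
  rw [e, pow_add, pow_add q, pow_add q ((a + 1).choose 2)] at h2
  have hs : (-1 : K) ^ a * (-1) ^ j ≠ 0 := by simp
  have hc : qPoch q a * qPoch q j * ((-1 : K) ^ a * (-1) ^ j) *
      ((q ^ (a + 1).choose 2)⁻¹ * (q ^ (j + 1).choose 2)⁻¹) ≠ 0 :=
    mul_ne_zero (mul_ne_zero (mul_ne_zero ha hj) hs)
      (mul_ne_zero (inv_ne_zero (pow_ne_zero _ hq0)) (inv_ne_zero (pow_ne_zero _ hq0)))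
  refine mul_right_cancel₀ hc ?_
  rw [mul_inv, mul_inv] at h2
  linear_combination h2

/-! ### The `q`-series identity behind the bar involution. -/

section Identity

variable {K : Type*} [Field K] {q : K}

open PowerSeries in
/-- `∑ q^{j(j+1)/2} x^j / (q;q)_j` times `∑ x^i / (q²;q²)_{⌊i/2⌋}` equals `∑ x^n / (q;q)_n`. -/
theorem sum_qPoch_inv (hq : ∀ n : ℕ, q ^ (n + 1) ≠ 1) (n : ℕ) :
    ∑ j ∈ Finset.range (n + 1),
      q ^ ((j + 1).choose 2) / qPoch q j * (qPoch (q ^ 2) ((n - j) / 2))⁻¹ = (qPoch q n)⁻¹ := by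
  have hq2 : ∀ n : ℕ, (q ^ 2) ^ (n + 1) ≠ 1 := fun n => by
    rw [← pow_mul]; exact hq (2 * n + 1)
  have hP := qPoch_ne_zero hq
  have hD := qPoch_ne_zero hq2
  -- Formally `F = ∏_{k≥1} (1 + q^k x)` and `G = (1 + x) ∏_{k≥0} (1 - q^{2k} x²)⁻¹`. The infinite
  -- products have no meaning for general `q` in `K`, so only their functional equations under `x ↦
  -- qx` are used.
  set F : K⟦X⟧ := PowerSeries.mk fun j => q ^ ((j + 1).choose 2) / qPoch q j with hF
  set G : K⟦X⟧ := PowerSeries.mk fun i => (qPoch (q ^ 2) (i / 2))⁻¹ with hG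
  have fF : F = (1 + C q * X) * rescale q F := by
    ext j
    rw [add_mul, one_mul, mul_assoc, map_add, coeff_C_mul]
    cases j with
    | zero => simp [hF]
    | succ j =>
      rw [coeff_succ_X_mul, coeff_rescale, coeff_rescale, hF, coeff_mk, coeff_mk,
        Nat.choose_succ_succ' (j + 1) 1, Nat.choose_one_right, qPoch_succ]
      have := hP j
      have h1 : 1 - q ^ (j + 1) ≠ 0 := sub_ne_zero.mpr (hq j).symm
      field_simp
      ring
  have fG : rescale q G = (1 - X) * (1 + C q * X) * G := by
    have e : (1 - X) * (1 + C q * X) * G = G + C (q - 1) * (X * G) - C q * (X * (X * G)) := by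
      rw [map_sub, map_one]; ring
    rw [e]
    ext i
    rw [map_sub, map_add, coeff_C_mul, coeff_C_mul, coeff_rescale]
    rcases i with _ | _ | i
    · simp [hG]
    · rw [coeff_succ_X_mul, coeff_succ_X_mul]
      simp [hG]
    · rw [coeff_succ_X_mul, coeff_succ_X_mul, coeff_succ_X_mul, hG, coeff_mk, coeff_mk, coeff_mk]
      rcases Nat.even_or_odd' i with ⟨m, rfl | rfl⟩
      · have e1 : (2 * m + 1 + 1) / 2 = m + 1 := by omega
        have e2 : (2 * m + 1) / 2 = m := by omega
        have e3 : 2 * m / 2 = m := by omega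
        rw [e1, e2, e3, qPoch_succ]
        have := hD m
        have h1 : 1 - (q ^ 2) ^ (m + 1) ≠ 0 := sub_ne_zero.mpr (hq2 m).symm
        field_simp
        ring
      · have e1 : (2 * m + 1 + 1 + 1) / 2 = m + 1 := by omega
        have e2 : (2 * m + 1 + 1) / 2 = m + 1 := by omega
        have e3 : (2 * m + 1) / 2 = m := by omega
        rw [e1, e2, e3, qPoch_succ]
        have := hD m
        have h1 : 1 - (q ^ 2) ^ (m + 1) ≠ 0 := sub_ne_zero.mpr (hq2 m).symm
        field_simp
        ring
  have fH : rescale q (F * G) = (1 - X) * (F * G) := by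
    rw [map_mul, fG]
    nth_rw 2 [fF]
    ring
  -- The equation `H(qx) = (1 - x) H(x)` says `(1 - q^{n+1}) h_{n+1} = h_n`, which together with
  -- `h_0 = 1` determines `H`.
  have key : ∀ n, coeff n (F * G) = (qPoch q n)⁻¹ := by
    intro n
    induction n with
    | zero => simp [hF, hG, coeff_mul]
    | succ n ih =>
      have h := congrArg (coeff (n + 1)) fH
      rw [coeff_rescale, sub_mul, one_mul, map_sub, coeff_succ_X_mul, ih] at h
      have h1 : 1 - q ^ (n + 1) ≠ 0 := sub_ne_zero.mpr (hq n).symm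
      rw [qPoch_succ, mul_inv, ← div_eq_mul_inv, eq_div_iff h1]
      linear_combination -h
  rw [← key n, coeff_mul, Finset.Nat.sum_antidiagonal_eq_sum_range_succ_mk]
  simp [hF, hG]

end Identity

/-! ### Coefficients of monomials and bar conjugates in `ℚ(v)`. -/

theorem vv_ne_zero : vv ≠ 0 := RatFunc.X_ne_zero

theorem vv_pow_ne_one {n : ℕ} (hn : n ≠ 0) : vv ^ n ≠ 1 := by
  intro h
  refine RatFunc.transcendental_X (K := ℚ) ⟨Polynomial.X ^ n - 1, ?_, ?_⟩
  · exact Polynomial.X_pow_sub_C_ne_zero (Nat.pos_of_ne_zero hn) 1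
  · have h' : (RatFunc.X : RatFunc ℚ) ^ n = 1 := h
    simp [h']

theorem vv_sq_pow_ne_one (n : ℕ) : (vv ^ 2) ^ (n + 1) ≠ 1 := by
  rw [← pow_mul]; exact vv_pow_ne_one (by omega)

theorem conjQv_vv_zpow (n : ℤ) : conjQv (vv ^ n) = vv ^ (-n) := by
  rw [map_zpow₀, conjQv_vv, inv_zpow']

theorem conjQv_conjQv (x : Qv) : conjQv (conjQv x) = x := by
  have h : conjQv.comp conjQv = RingHom.id Qv := by
    refine IsFractionRing.ringHom_ext (A := Polynomial ℚ) ?_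
    intro p
    have : ((conjQv.comp conjQv).comp (algebraMap (Polynomial ℚ) Qv)) =
        (RingHom.id Qv).comp (algebraMap (Polynomial ℚ) Qv) := by
      apply Polynomial.ringHom_ext
      · intro a; simp
      · have := conjQv_vv
        rw [vv] at this
        simp [this]
    exact congrArg (fun f => f p) this
  exact congrArg (fun f => f x) h

/-- The coefficient of `[A_{a+j,r-j}]` in `M_{a,r}`. -/
def monoCoeff (a j : ℕ) : Qv :=
  vv ^ (-(((j + 1).choose 2 : ℕ) : ℤ) - (a : ℤ) * j) *
    Polynomial.aeval (vv ^ 2) (gaussBinom (a + j) a)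

/-- The coefficient of `[A_{a+i,r-i}]` in the bar conjugate of `[A_{a,r}]`. -/
def barCoeff (a i : ℕ) : Qv :=
  (∏ k ∈ Finset.Icc 1 i, (vv ^ (-(a : ℤ) - (k : ℤ)) - vv ^ (a + k))) /
    ∏ k ∈ Finset.Icc 1 (i / 2), (1 - vv ^ (4 * k))

theorem monoCoeff_zero (a : ℕ) : monoCoeff a 0 = 1 := by
  simp [monoCoeff, gaussBinom_self]

/-- This is the passage between the two formulas in (3): `v^{-a-k}` is taken out of each factor. -/
theorem prod_sub_eq (a i : ℕ) :
    ∏ k ∈ Finset.Icc 1 i, (vv ^ (-(a : ℤ) - (k : ℤ)) - vv ^ (a + k)) =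
      vv ^ (-((i : ℤ) * a) - ((i + 1).choose 2 : ℤ)) *
        ∏ k ∈ Finset.Icc 1 i, (1 - vv ^ (2 * (a + k))) := by
  have hv := vv_ne_zero
  induction i with
  | zero => simp
  | succ i ih =>
    rw [Finset.prod_Icc_succ_top (by omega), Finset.prod_Icc_succ_top (by omega), ih,
      Nat.choose_succ_succ' (i + 1) 1, Nat.choose_one_right]
    have e1 : vv ^ (-(a : ℤ) - ((i + 1 : ℕ) : ℤ)) - vv ^ (a + (i + 1)) =
        vv ^ (-(a : ℤ) - ((i + 1 : ℕ) : ℤ)) * (1 - vv ^ (2 * (a + (i + 1)))) := by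
      rw [mul_sub, mul_one, ← zpow_natCast, ← zpow_natCast, ← zpow_add₀ hv]
      congr 2
      push_cast; ring
    have e2 : -(((i + 1 : ℕ) : ℤ) * a) - ((i + 1 + (i + 1).choose 2 : ℕ) : ℤ) =
        (-((i : ℤ) * a) - ((i + 1).choose 2 : ℤ)) + (-(a : ℤ) - ((i + 1 : ℕ) : ℤ)) := by
      push_cast; ring
    rw [e1, show 1 + 1 = 2 from rfl, e2, zpow_add₀ hv]
    ring

theorem barCoeff_eq (a i : ℕ) :
    barCoeff a i = vv ^ (-((i : ℤ) * a) - ((i + 1).choose 2 : ℤ)) *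
      (qPoch (vv ^ 2) (a + i) / qPoch (vv ^ 2) a) * (qPoch ((vv ^ 2) ^ 2) (i / 2))⁻¹ := by
  have h1 : ∏ k ∈ Finset.Icc 1 i, (1 - vv ^ (2 * (a + k))) =
      qPoch (vv ^ 2) (a + i) / qPoch (vv ^ 2) a := by
    rw [eq_div_iff (qPoch_ne_zero vv_sq_pow_ne_one a)]
    induction i with
    | zero => simp
    | succ i ih =>
      rw [Finset.prod_Icc_succ_top (by omega), ← add_assoc a i 1, qPoch_succ, ← ih, ← pow_mul]
      ring
  have h2 : ∏ k ∈ Finset.Icc 1 (i / 2), (1 - vv ^ (4 * k)) = qPoch ((vv ^ 2) ^ 2) (i / 2) := by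
    rw [qPoch, Finset.range_eq_Ico, Finset.prod_Ico_add' (fun k => 1 - ((vv ^ 2) ^ 2) ^ k) 0 _ 1]
    refine Finset.prod_congr ?_ fun k _ => ?_
    · ext k; simp only [Finset.mem_Icc, Finset.mem_Ico]; omega
    · rw [← pow_mul, ← pow_mul, ← mul_assoc]; norm_num
  rw [barCoeff, prod_sub_eq, h1, h2, div_eq_mul_inv _ (qPoch ((vv ^ 2) ^ 2) (i / 2))]

theorem conjQv_monoCoeff (a j : ℕ) :
    conjQv (monoCoeff a j) = vv ^ ((((j + 1).choose 2 : ℕ) : ℤ) - (a : ℤ) * j) *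
      (qPoch (vv ^ 2) (a + j) / (qPoch (vv ^ 2) a * qPoch (vv ^ 2) j)) := by
  have hv := vv_ne_zero
  have h0 := qPoch_ne_zero vv_sq_pow_ne_one
  have h1 : conjQv (Polynomial.aeval (vv ^ 2) (gaussBinom (a + j) a)) =
      Polynomial.aeval (vv ^ 2)⁻¹ (gaussBinom (a + j) a) := by
    have := Polynomial.hom_eval₂ (gaussBinom (a + j) a) (algebraMap ℤ Qv) conjQv (vv ^ 2)
    rw [← Polynomial.aeval_def, map_pow, conjQv_vv, inv_pow] at this
    rw [this, Polynomial.aeval_def, Subsingleton.elim (conjQv.comp (algebraMap ℤ Qv))]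
  rw [monoCoeff, map_mul, h1, conjQv_vv_zpow, aeval_gaussBinom_inv (pow_ne_zero _ hv)
    vv_sq_pow_ne_one, eq_div_of_mul_eq (mul_ne_zero (h0 a) (h0 j))
    (aeval_gaussBinom_mul_qPoch (vv ^ 2) a j), ← mul_assoc]
  congr 1
  rw [← pow_mul, ← zpow_natCast, ← zpow_neg, ← zpow_add₀ hv]
  congr 1
  push_cast; ring

/-- The coefficient identity for `barI` to fix `M_{a,r}`. In each summand `(q;q)_{a+j}` cancels, and
a factor depending only on `a` and `n` splits off. What remains is the summand of `sum_qPoch_inv` at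
`q = v²`. -/
theorem sum_conjQv_monoCoeff_mul_barCoeff (a n : ℕ) :
    ∑ j ∈ Finset.range (n + 1), conjQv (monoCoeff a j) * barCoeff (a + j) (n - j) =
      monoCoeff a n := by
  have hv := vv_ne_zero
  have h0 := qPoch_ne_zero vv_sq_pow_ne_one
  have hterm : ∀ j ∈ Finset.range (n + 1), conjQv (monoCoeff a j) * barCoeff (a + j) (n - j) =
      vv ^ (-(((n + 1).choose 2 : ℕ) : ℤ) - (a : ℤ) * n) *
        (qPoch (vv ^ 2) (a + n) / qPoch (vv ^ 2) a) *
      ((vv ^ 2) ^ ((j + 1).choose 2) / qPoch (vv ^ 2) j *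
        (qPoch ((vv ^ 2) ^ 2) ((n - j) / 2))⁻¹) := by
    intro j hj
    obtain ⟨i, rfl⟩ := Nat.exists_eq_add_of_le (Nat.lt_succ_iff.mp (Finset.mem_range.mp hj))
    rw [Nat.add_sub_cancel_left, conjQv_monoCoeff, barCoeff_eq, ← add_assoc]
    have e : vv ^ ((((j + 1).choose 2 : ℕ) : ℤ) - (a : ℤ) * j) *
        vv ^ (-((i : ℤ) * ((a + j : ℕ) : ℤ)) - ((i + 1).choose 2 : ℤ)) =
        vv ^ (-(((j + i + 1).choose 2 : ℕ) : ℤ) - (a : ℤ) * ((j + i : ℕ) : ℤ)) *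
          (vv ^ 2) ^ ((j + 1).choose 2) := by
      rw [← pow_mul, ← zpow_natCast, ← zpow_add₀ hv, ← zpow_add₀ hv]
      congr 1
      have t1 := two_mul_choose_succ_two j
      have t2 := two_mul_choose_succ_two i
      have t3 := two_mul_choose_succ_two (j + i)
      push_cast at t3 ⊢
      linarith
    have := h0 a
    have := h0 j
    have := h0 (a + j)
    rw [show ∀ x y z w u : Qv, x * y * (z * w * u) = (x * z) * (y * w * u) by intros; ring]
    rw [e]
    field_simp
  rw [Finset.sum_congr rfl hterm, ← Finset.mul_sum, sum_qPoch_inv vv_sq_pow_ne_one, monoCoeff,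
    eq_div_of_mul_eq (mul_ne_zero (h0 a) (h0 n)) (aeval_gaussBinom_mul_qPoch (vv ^ 2) a n)]
  have := h0 a
  have := h0 n
  field_simp

/-! ### Counting subspaces -/

/-- Since `q^i - q^{a+j} = q^i (1 - q^{a+j-i})`, the product is a power of `q` times the last `a`
factors of `(q;q)_{a+j}`. This converts counts of independent tuples into Pochhammer symbols. -/
theorem prod_pow_sub_pow_mul_qPoch {R : Type*} [CommRing R] (q : R) (a j : ℕ) :
    (∏ i ∈ Finset.range a, (q ^ i - q ^ (a + j))) * qPoch q j =
      (∏ i ∈ Finset.range a, q ^ i) * qPoch q (a + j) := by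
  induction a with
  | zero => simp
  | succ a ih =>
    have h : ∏ i ∈ Finset.range a, (q ^ (i + 1) - q ^ (a + 1 + j)) =
        q ^ a * ∏ i ∈ Finset.range a, (q ^ i - q ^ (a + j)) := by
      have hq : q ^ a = ∏ _i ∈ Finset.range a, q := by simp
      rw [hq, ← Finset.prod_mul_distrib]
      exact Finset.prod_congr rfl fun i _ => by ring
    rw [Finset.prod_range_succ', h, Finset.prod_range_succ, show a + 1 + j = a + j + 1 by omega,
      qPoch_succ]
    linear_combination q ^ a * (1 - q ^ (a + j + 1)) * ih

section Counting

variable (K E : Type*) [Field K] [Fintype K] [AddCommGroup E] [Module K E] [Finite E]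

open Module

/-- Linearly independent `a`-tuples with span `U` are the linearly independent `a`-tuples in `U`. -/
def linearIndependentSpanEquiv {a : ℕ} (U : Submodule K E) (hU : finrank K U = a) :
    {s : {s : Fin a → E // LinearIndependent K s} // Submodule.span K (Set.range s.1) = U} ≃
      {t : Fin a → U // LinearIndependent K t} where
  toFun s := ⟨fun i => ⟨s.1.1 i, s.2.le (Submodule.subset_span ⟨i, rfl⟩)⟩,
    LinearIndependent.of_comp U.subtype s.1.2⟩
  invFun t := ⟨⟨fun i => t.1 i, t.2.map' U.subtype U.ker_subtype⟩, by
    have := Module.Finite.of_finite (R := K) (M := E)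
    refine Submodule.eq_of_le_of_finrank_eq ?_ ?_
    · rw [Submodule.span_le]
      rintro _ ⟨i, rfl⟩
      exact (t.1 i).2
    · exact (finrank_span_eq_card (t.2.map' U.subtype U.ker_subtype)).trans (by
        rw [hU, Fintype.card_fin])⟩
  left_inv _ := rfl
  right_inv _ := rfl

/-- Linearly independent `a`-tuples are counted by their span; every `a`-dimensional subspace has
the same number of ordered bases. -/
theorem card_submodule_mul_prod {a : ℕ} (ha : a ≤ finrank K E) :
    Nat.card {U : Submodule K E // finrank K U = a} *
        ∏ i : Fin a, (Fintype.card K ^ a - Fintype.card K ^ i.val) =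
      ∏ i : Fin a, (Fintype.card K ^ finrank K E - Fintype.card K ^ i.val) := by
  classical
  let f : {s : Fin a → E // LinearIndependent K s} → {U : Submodule K E // finrank K U = a} :=
    fun s => ⟨Submodule.span K (Set.range s.1), by
      rw [finrank_span_eq_card s.2, Fintype.card_fin]⟩
  have : Finite (Submodule K E) := Finite.of_injective _ SetLike.coe_injective
  have := Fintype.ofFinite {U : Submodule K E // finrank K U = a}
  rw [← card_linearIndependent ha, ← Nat.card_congr (Equiv.sigmaFiberEquiv f), Nat.card_sigma,
    Finset.sum_congr rfl (g := fun _ =>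
      ∏ i : Fin a, (Fintype.card K ^ a - Fintype.card K ^ i.val)), Finset.sum_const,
    Finset.card_univ, Nat.card_eq_fintype_card, smul_eq_mul]
  rintro ⟨U, hU⟩ -
  have e : {s // f s = ⟨U, hU⟩} ≃
      {s : {s : Fin a → E // LinearIndependent K s} // Submodule.span K (Set.range s.1) = U} :=
    Equiv.subtypeEquivRight fun s => Subtype.ext_iff
  rw [Nat.card_congr (e.trans (linearIndependentSpanEquiv K E U hU)),
    card_linearIndependent hU.ge, hU]

/-- The Gaussian binomial coefficient counts subspaces. -/
theorem card_submodule_finrank_eq (a : ℕ) :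
    (Nat.card {U : Submodule K E // finrank K U = a} : ℤ) =
      (gaussBinom (finrank K E) a).eval (Fintype.card K : ℤ) := by
  have := Module.Finite.of_finite (R := K) (M := E)
  rcases lt_or_ge (finrank K E) a with h | h
  · rw [gaussBinom_eq_zero h, Polynomial.eval_zero, Nat.cast_eq_zero, Nat.card_eq_zero]
    exact Or.inl ⟨fun U => absurd (Submodule.finrank_le U.1) (by rw [U.2]; omega)⟩
  obtain ⟨j, hj⟩ := Nat.exists_eq_add_of_le h
  have hc := card_submodule_mul_prod K E h
  rw [hj] at hc ⊢
  set q := Fintype.card K with hq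
  have hq1 : 1 < q := Fintype.one_lt_card
  -- The truncated subtraction is exact because `i < a ≤ n`. Reversing each difference gives the
  -- sign `(-1)^a`.
  have hcast (n : ℕ) (hn : a ≤ n) : ((∏ i : Fin a, (q ^ n - q ^ i.val) : ℕ) : ℤ) =
      (-1) ^ a * ∏ i ∈ Finset.range a, ((q : ℤ) ^ i - (q : ℤ) ^ n) := by
    rw [Finset.prod_range, Nat.cast_prod]
    have : ((-1 : ℤ) ^ a) = ∏ _i : Fin a, (-1 : ℤ) := by simp
    rw [this, ← Finset.prod_mul_distrib]
    refine Finset.prod_congr rfl fun i _ => ?_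
    rw [Nat.cast_sub (Nat.pow_le_pow_right hq1.le (i.2.le.trans hn))]
    push_cast
    ring
  have hc' := congrArg (Nat.cast : ℕ → ℤ) hc
  rw [Nat.cast_mul, hcast a le_rfl, hcast (a + j) (Nat.le_add_right a j)] at hc'
  have hne : ∀ n : ℕ, (q : ℤ) ^ (n + 1) ≠ 1 := fun n => by
    exact_mod_cast (Nat.one_lt_pow (Nat.succ_ne_zero n) hq1).ne'
  have h1 := prod_pow_sub_pow_mul_qPoch (q : ℤ) a 0
  have h2 := prod_pow_sub_pow_mul_qPoch (q : ℤ) a j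
  have h3 := aeval_gaussBinom_mul_qPoch (q : ℤ) a j
  rw [add_zero, qPoch_zero, mul_one] at h1
  rw [Polynomial.coe_aeval_eq_eval] at h3
  have hp : ∏ i ∈ Finset.range a, (q : ℤ) ^ i ≠ 0 :=
    Finset.prod_ne_zero_iff.mpr fun i _ => pow_ne_zero _ (by exact_mod_cast (by omega : q ≠ 0))
  have hcancel : (-1 : ℤ) ^ a * (∏ i ∈ Finset.range a, (q : ℤ) ^ i) *
      (qPoch (q : ℤ) a * qPoch (q : ℤ) j) ≠ 0 :=
    mul_ne_zero (mul_ne_zero (by simp) hp)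
      (mul_ne_zero (qPoch_ne_zero hne a) (qPoch_ne_zero hne j))
  refine mul_right_cancel₀ hcancel ?_
  rw [h1] at hc'
  linear_combination qPoch (q : ℤ) j * hc' + (-1) ^ a * h2 -
    (-1) ^ a * (∏ i ∈ Finset.range a, (q : ℤ) ^ i) * h3

theorem card_submodule_le_finrank_eq (P : Submodule K E) (a : ℕ) :
    (Nat.card {U : Submodule K E // U ≤ P ∧ finrank K U = a} : ℤ) =
      (gaussBinom (finrank K P) a).eval (Fintype.card K : ℤ) := by
  rw [← card_submodule_finrank_eq]
  congr 1
  refine Nat.card_congr ?_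
  refine (Equiv.subtypeSubtypeEquivSubtypeInter _ _).symm.trans ?_
  refine ((Submodule.mapIic P).toEquiv.subtypeEquiv fun U => ?_).symm
  change _ ↔ finrank K (U.map P.subtype) = a
  rw [LinearEquiv.finrank_eq (Submodule.equivSubtypeMap P U)]

end Counting

/-! ### Three-step isotropic flags -/

section Flags

open Module

variable {F : Type} [Field F] {d : ℕ}

theorem quadForm_apply (x y : Fin (2 * d + 1) → F) :
    quadForm F d x y = ∑ i, x i * y i.rev := by
  rw [quadForm, Matrix.toBilin'_apply]
  simp

theorem quadForm_isSymm : (quadForm F d).IsSymm := by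
  refine ⟨fun x y => ?_⟩
  rw [quadForm_apply, quadForm_apply, ← Equiv.sum_comp Fin.revPerm]
  simp [mul_comm]

theorem quadForm_single_left (i : Fin (2 * d + 1)) (y : Fin (2 * d + 1) → F) :
    quadForm F d (Pi.single i 1) y = y i.rev := by
  rw [quadForm_apply, Finset.sum_eq_single i] <;> simp +contextual

theorem quadForm_nondegenerate : (quadForm F d).Nondegenerate := by
  refine LinearMap.BilinForm.Nondegenerate.ofSeparatingRight fun y hy => ?_
  ext i
  have := hy (Pi.single i.rev 1)
  rwa [quadForm_single_left, Fin.rev_rev] at this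

namespace IsoFlag

theorem space_two (V : IsoFlag F 3 d) :
    V.space 2 = (quadForm F d).orthogonal (V.space 1) := V.orth 1

theorem space_one_le_space_two (V : IsoFlag F 3 d) : V.space 1 ≤ V.space 2 :=
  V.mono (by decide)

theorem finrank_space_one_add (V : IsoFlag F 3 d) :
    finrank F (V.space 1) + finrank F (V.space 2) = 2 * d + 1 := by
  have h := LinearMap.BilinForm.finrank_orthogonal quadForm_nondegenerate (V.space 1)
  have h' := Submodule.finrank_le (V.space 1)
  rw [finrank_fin_fun] at h h'
  rw [space_two, h]
  omega

theorem ext_space_one {V W : IsoFlag F 3 d} (h : V.space 1 = W.space 1) : V = W := by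
  have : V.space = W.space := by
    funext i
    fin_cases i
    · exact V.bot.trans W.bot.symm
    · exact h
    · exact V.space_two.trans (by rw [h, ← W.space_two]; rfl)
    · exact V.top.trans W.top.symm
  cases V; cases W; cases this; rfl

/-- The flag `0 ⊆ U ⊆ U^⊥ ⊆ F^{2d+1}` of an isotropic subspace `U`. -/
def ofIsotropic (U : Submodule F (Fin (2 * d + 1) → F))
    (hU : U ≤ (quadForm F d).orthogonal U) : IsoFlag F 3 d where
  space := ![⊥, U, (quadForm F d).orthogonal U, ⊤]
  mono := by
    refine Fin.monotone_iff_le_succ.mpr fun i => ?_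
    fin_cases i
    · exact bot_le
    · exact hU
    · exact le_top
  bot := rfl
  top := rfl
  orth i := by
    fin_cases i
    · exact LinearMap.BilinForm.orthogonal_bot.symm
    · rfl
    · exact (LinearMap.BilinForm.orthogonal_orthogonal quadForm_nondegenerate
        quadForm_isSymm.isRefl U).symm
    · exact (LinearMap.BilinForm.orthogonal_top_eq_bot quadForm_nondegenerate).symm

end IsoFlag

theorem RelPos.finrank_left {n : ℕ} {A : Matrix (Fin n) (Fin n) ℕ} {V W : IsoFlag F n d}
    (h : RelPos A V W) (i : Fin (n + 1)) :
    finrank F (V.space i) = ∑ k : Fin n, ∑ l : Fin n, if k.val < i.val then A k l else 0 := by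
  have := h i (Fin.last n)
  rw [W.top, inf_top_eq] at this
  simpa using this

theorem relPos_transpose {n : ℕ} {A : Matrix (Fin n) (Fin n) ℕ} {V W : IsoFlag F n d} :
    RelPos A.transpose V W ↔ RelPos A W V := by
  unfold RelPos
  rw [forall_comm]
  refine forall_congr' fun i => forall_congr' fun j => ?_
  rw [inf_comm, Finset.sum_comm]
  simp only [Matrix.transpose_apply, and_comm]

theorem RelPos.finrank_right {n : ℕ} {A : Matrix (Fin n) (Fin n) ℕ} {V W : IsoFlag F n d}
    (h : RelPos A V W) (j : Fin (n + 1)) :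
    finrank F (W.space j) = ∑ l : Fin n, ∑ k : Fin n, if l.val < j.val then A k l else 0 :=
  (relPos_transpose.mpr h).finrank_left j

/-- The matrix `X` of `M_{a,r}`. -/
def Xmat (a r : ℕ) : Matrix (Fin 3) (Fin 3) ℕ := !![a, r, 0; 0, 1, 0; 0, r, a]

/-- The matrix `Y` of `M_{a,r}`. -/
def Ymat (a r : ℕ) : Matrix (Fin 3) (Fin 3) ℕ := !![a, 0, 0; r, 1, r; 0, 0, a]

theorem Xmat_transpose (a r : ℕ) : (Xmat a r).transpose = Ymat a r := by
  ext i j; fin_cases i <;> fin_cases j <;> rfl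

theorem fin_four_cases : ∀ i : Fin (3 + 1), i = 0 ∨ i = 1 ∨ i = 2 ∨ i = 3 := by decide

/-- Of the sixteen rank conditions, those with an index `0` or `3` reduce to the dimensions of the
single spaces. -/
theorem relPos_of_finrank {A : Matrix (Fin 3) (Fin 3) ℕ} {V W : IsoFlag F 3 d}
    (htot : ∑ i, ∑ j, A i j = 2 * d + 1)
    (hV1 : finrank F (V.space 1) = A 0 0 + A 0 1 + A 0 2)
    (hV2 : finrank F (V.space 2) = A 0 0 + A 0 1 + A 0 2 + (A 1 0 + A 1 1 + A 1 2))
    (hW1 : finrank F (W.space 1) = A 0 0 + A 1 0 + A 2 0)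
    (hW2 : finrank F (W.space 2) = A 0 0 + A 1 0 + A 2 0 + (A 0 1 + A 1 1 + A 2 1))
    (h11 : finrank F (V.space 1 ⊓ W.space 1 : Submodule F _) = A 0 0)
    (h12 : finrank F (V.space 1 ⊓ W.space 2 : Submodule F _) = A 0 0 + A 0 1)
    (h21 : finrank F (V.space 2 ⊓ W.space 1 : Submodule F _) = A 0 0 + A 1 0)
    (h22 : finrank F (V.space 2 ⊓ W.space 2 : Submodule F _) =
      A 0 0 + A 0 1 + (A 1 0 + A 1 1)) :
    RelPos A V W := by
  have b1 (P : Submodule F _) : finrank F (V.space 0 ⊓ P : Submodule F _) = 0 := by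
    rw [V.bot, bot_inf_eq, finrank_bot]
  have b2 (P : Submodule F _) : finrank F (P ⊓ W.space 0 : Submodule F _) = 0 := by
    rw [W.bot, inf_bot_eq, finrank_bot]
  have e1 : V.space 3 = ⊤ := V.top
  have e2 : W.space 3 = ⊤ := W.top
  have t1 : finrank F (V.space 3 ⊓ W.space 1 : Submodule F _) = finrank F (W.space 1) := by
    rw [e1, top_inf_eq]
  have t2 : finrank F (V.space 3 ⊓ W.space 2 : Submodule F _) = finrank F (W.space 2) := by
    rw [e1, top_inf_eq]
  have t1' : finrank F (V.space 1 ⊓ W.space 3 : Submodule F _) = finrank F (V.space 1) := by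
    rw [e2, inf_top_eq]
  have t2' : finrank F (V.space 2 ⊓ W.space 3 : Submodule F _) = finrank F (V.space 2) := by
    rw [e2, inf_top_eq]
  have t3 : finrank F (V.space 3 ⊓ W.space 3 : Submodule F _) = 2 * d + 1 := by
    rw [e1, e2, top_inf_eq, finrank_top, finrank_fin_fun]
  simp only [Fin.sum_univ_three] at htot
  intro i j
  rcases fin_four_cases i with rfl | rfl | rfl | rfl <;>
    rcases fin_four_cases j with rfl | rfl | rfl | rfl <;>
    simp [Fin.sum_univ_three, b1, b2, t1, t2, t1', t2', t3, h11, h12, h21, h22, hV1, hV2, hW1,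
      hW2] <;> omega

/-- The inclusion `W_1 ⊆ V_1` dualises to `V_2 ⊆ W_2`. So `W_1 ⊆ V_1 ⊆ V_2 ⊆ W_2`, and all
intersections are read off from this chain. -/
theorem relPos_Xmat {a r : ℕ} (h : a + r = d) {V W : IsoFlag F 3 d} :
    RelPos (Xmat a r) V W ↔
      finrank F (V.space 1) = d ∧ W.space 1 ≤ V.space 1 ∧ finrank F (W.space 1) = a := by
  constructor
  · intro H
    have h1 := H.finrank_left 1
    have h2 := H.finrank_right 1
    have h3 := H 1 1
    simp [Xmat, Fin.sum_univ_three] at h1 h2 h3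
    refine ⟨h1.trans h, ?_, h2⟩
    exact inf_eq_right.mp (Submodule.eq_of_le_of_finrank_eq inf_le_right (h3.trans h2.symm))
  · rintro ⟨h1, h2, h3⟩
    have hV := V.finrank_space_one_add
    have hW := W.finrank_space_one_add
    have h4 : V.space 2 ≤ W.space 2 := by
      rw [V.space_two, W.space_two]
      exact LinearMap.BilinForm.orthogonal_le h2
    have e11 : finrank F (V.space 1 ⊓ W.space 1 : Submodule F _) = a := by
      rw [inf_eq_right.mpr h2, h3]
    have e12 : finrank F (V.space 1 ⊓ W.space 2 : Submodule F _) = d := by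
      rw [inf_eq_left.mpr (V.space_one_le_space_two.trans h4), h1]
    have e21 : finrank F (V.space 2 ⊓ W.space 1 : Submodule F _) = a := by
      rw [inf_eq_right.mpr (h2.trans V.space_one_le_space_two), h3]
    have e22 : finrank F (V.space 2 ⊓ W.space 2 : Submodule F _) = finrank F (V.space 2) := by
      rw [inf_eq_left.mpr h4]
    clear h2 h4
    apply relPos_of_finrank <;> simp [Fin.sum_univ_three, Xmat, *] <;> omega

theorem relPos_Ymat {a r : ℕ} (h : a + r = d) {V W : IsoFlag F 3 d} :
    RelPos (Ymat a r) W V ↔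
      finrank F (V.space 1) = d ∧ W.space 1 ≤ V.space 1 ∧ finrank F (W.space 1) = a := by
  rw [← Xmat_transpose, relPos_transpose, relPos_Xmat h]

/-- The flag `W` is determined by `W_1`, and any subspace of the isotropic space `V_1` is isotropic.
Hence the choice of `W_1` inside `V_1 ∩ V'_1` is constrained only in its dimension. -/
theorem card_relPos_Xmat_Ymat [Fintype F] {a r : ℕ} (h : a + r = d) {V V' : IsoFlag F 3 d}
    (hV : finrank F (V.space 1) = d) (hV' : finrank F (V'.space 1) = d) :
    (Nat.card {W : IsoFlag F 3 d // RelPos (Xmat a r) V W ∧ RelPos (Ymat a r) W V'} : ℤ) =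
      (gaussBinom (finrank F (V.space 1 ⊓ V'.space 1 : Submodule F _)) a).eval
        (Fintype.card F : ℤ) := by
  rw [← card_submodule_le_finrank_eq]
  congr 1
  refine Nat.card_congr
    { toFun := fun W => ⟨W.1.space 1, ?_⟩
      invFun := fun U => ⟨IsoFlag.ofIsotropic U.1 ?_, ?_⟩
      left_inv := ?_
      right_inv := ?_ }
  · obtain ⟨W, h1, h2⟩ := W
    rw [relPos_Xmat h] at h1
    rw [relPos_Ymat h] at h2
    exact ⟨le_inf h1.2.1 h2.2.1, h1.2.2⟩
  · have h1 : U.1 ≤ V.space 1 := U.2.1.trans inf_le_left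
    refine h1.trans (V.space_one_le_space_two.trans ?_)
    rw [V.space_two]
    exact LinearMap.BilinForm.orthogonal_le h1
  · rw [relPos_Xmat h, relPos_Ymat h]
    exact ⟨⟨hV, U.2.1.trans inf_le_left, U.2.2⟩, hV', U.2.1.trans inf_le_right, U.2.2⟩
  · exact fun W => Subtype.ext (IsoFlag.ext_space_one rfl)
  · exact fun U => rfl

/-! ### Coordinate flags -/

variable (F d) in
/-- The subspace of vectors supported in the coordinates that satisfy `p`. -/
def coordSubmodule (p : Fin (2 * d + 1) → Prop) : Submodule F (Fin (2 * d + 1) → F) where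
  carrier := {x | ∀ i, ¬ p i → x i = 0}
  add_mem' hx hy i hi := by simp [hx i hi, hy i hi]
  zero_mem' _ _ := rfl
  smul_mem' c x hx i hi := by simp [hx i hi]

theorem mem_coordSubmodule {p : Fin (2 * d + 1) → Prop} {x : Fin (2 * d + 1) → F} :
    x ∈ coordSubmodule F d p ↔ ∀ i, ¬ p i → x i = 0 := Iff.rfl

theorem coordSubmodule_inf (p p' : Fin (2 * d + 1) → Prop) :
    coordSubmodule F d p ⊓ coordSubmodule F d p' = coordSubmodule F d fun i => p i ∧ p' i := by
  ext x
  simp only [Submodule.mem_inf, mem_coordSubmodule, ← forall_and]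
  refine forall_congr' fun i => ?_
  tauto

theorem single_mem_coordSubmodule {p : Fin (2 * d + 1) → Prop} {i : Fin (2 * d + 1)} (hi : p i) :
    Pi.single i (1 : F) ∈ coordSubmodule F d p := by
  intro j hj
  rw [Pi.single_eq_of_ne]
  rintro rfl
  exact hj hi

theorem orthogonal_coordSubmodule (p : Fin (2 * d + 1) → Prop) :
    (quadForm F d).orthogonal (coordSubmodule F d p) =
      coordSubmodule F d fun i => ¬ p i.rev := by
  ext y
  rw [LinearMap.BilinForm.mem_orthogonal_iff, mem_coordSubmodule]
  constructor
  · intro h i hi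
    have := h _ (single_mem_coordSubmodule (F := F) (not_not.mp hi))
    rwa [quadForm_single_left, Fin.rev_rev] at this
  · intro h x hx
    rw [quadForm_apply]
    refine Finset.sum_eq_zero fun i _ => ?_
    by_cases hi : p i
    · rw [h i.rev (by simpa using hi), mul_zero]
    · rw [hx i hi, zero_mul]

open Classical in
theorem finrank_coordSubmodule (p : Fin (2 * d + 1) → Prop) :
    finrank F (coordSubmodule F d p) = (Finset.univ.filter p).card := by
  have e : coordSubmodule F d p ≃ₗ[F] ({i // p i} → F) :=
    { toFun := fun x i => x.1 i.1
      map_add' := fun _ _ => rfl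
      map_smul' := fun _ _ => rfl
      invFun := fun y => ⟨fun i => if h : p i then y ⟨i, h⟩ else 0, fun i hi => dif_neg hi⟩
      left_inv := fun x => by
        ext i
        by_cases hi : p i
        · simp [hi]
        · simp [hi, x.2 i hi]
      right_inv := fun y => by ext i; simp [i.2] }
  rw [e.finrank_eq, finrank_fintype_fun_eq_card, Fintype.card_subtype]

theorem finrank_coordSubmodule_of_iff {p : Fin (2 * d + 1) → Prop} {c u w : ℕ} (hcu : c ≤ u)
    (huw : u ≤ w) (hw : w ≤ 2 * d + 1) (hp : ∀ i, p i ↔ i.val < c ∨ u ≤ i.val ∧ i.val < w) :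
    finrank F (coordSubmodule F d p) = c + (w - u) := by
  classical
  rw [finrank_coordSubmodule, ← Finset.card_map Fin.valEmbedding]
  have : (Finset.univ.filter p).map Fin.valEmbedding = Finset.range c ∪ Finset.Ico u w := by
    ext k
    simp only [Finset.mem_map, Finset.mem_filter, Finset.mem_univ, true_and, hp,
      Fin.valEmbedding_apply, Finset.mem_union, Finset.mem_range, Finset.mem_Ico]
    constructor
    · rintro ⟨i, hi, rfl⟩
      exact hi
    · intro hk
      exact ⟨⟨k, by omega⟩, hk, rfl⟩
  rw [this, Finset.card_union_of_disjoint, Finset.card_range, Nat.card_Ico]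
  rw [Finset.disjoint_left]
  intro k hk hk'
  rw [Finset.mem_range] at hk
  rw [Finset.mem_Ico] at hk'
  omega

theorem exists_relPos_Amat (F : Type) [Field F] {c s : ℕ} (h : c + s = d) :
    ∃ V V' : IsoFlag F 3 d, RelPos (Amat c s) V V' := by
  have hrev (i : Fin (2 * d + 1)) : i.rev.val = 2 * d - i.val := by
    rw [Fin.val_rev]; omega
  let p : Fin (2 * d + 1) → Prop := fun i => i.val < d
  -- The coordinates `c, …, d-1` of `p` are replaced by their mirror images `2d - i`, which are
  -- `d+1, …, d+s`. No coordinate occurs together with its mirror image, so the span stays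
  -- isotropic.
  let p' : Fin (2 * d + 1) → Prop := fun i => i.val < c ∨ d < i.val ∧ i.val ≤ d + s
  have mono {p₁ p₂ : Fin (2 * d + 1) → Prop} (hp : ∀ i, p₁ i → p₂ i) :
      coordSubmodule F d p₁ ≤ coordSubmodule F d p₂ :=
    fun x hx i hi => hx i fun h => hi (hp i h)
  have hV : coordSubmodule F d p ≤ (quadForm F d).orthogonal (coordSubmodule F d p) := by
    rw [orthogonal_coordSubmodule]
    refine mono fun i => ?_
    simp only [p, hrev]
    omega
  have hV' : coordSubmodule F d p' ≤ (quadForm F d).orthogonal (coordSubmodule F d p') := by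
    rw [orthogonal_coordSubmodule]
    refine mono fun i => ?_
    simp only [p', hrev]
    omega
  let V := IsoFlag.ofIsotropic _ hV
  let V' := IsoFlag.ofIsotropic _ hV'
  have f1 : finrank F (V.space 1) = d := by
    refine (finrank_coordSubmodule_of_iff (c := d) (u := d) (w := d) le_rfl le_rfl (by omega)
      fun i => ?_).trans (by omega)
    simp only [p]; omega
  have f1' : finrank F (V'.space 1) = d := by
    refine (finrank_coordSubmodule_of_iff (c := c) (u := d + 1) (w := d + s + 1) (by omega)
      (by omega) (by omega) fun i => ?_).trans (by omega)
    simp only [p']; omega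
  have f2 := V.finrank_space_one_add
  have f2' := V'.finrank_space_one_add
  have o : V.space 2 = coordSubmodule F d fun i => ¬ p i.rev := orthogonal_coordSubmodule p
  have o' : V'.space 2 = coordSubmodule F d fun i => ¬ p' i.rev := orthogonal_coordSubmodule p'
  have g11 : finrank F (V.space 1 ⊓ V'.space 1 : Submodule F _) = c := by
    change finrank F (coordSubmodule F d p ⊓ coordSubmodule F d p' : Submodule F _) = c
    rw [coordSubmodule_inf]
    refine (finrank_coordSubmodule_of_iff (c := c) (u := d) (w := d) (by omega) le_rfl (by omega)
      fun i => ?_).trans (by omega)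
    simp only [p, p']; omega
  have g12 : finrank F (V.space 1 ⊓ V'.space 2 : Submodule F _) = c := by
    rw [o']
    change finrank F (coordSubmodule F d p ⊓ _ : Submodule F _) = c
    rw [coordSubmodule_inf]
    refine (finrank_coordSubmodule_of_iff (c := c) (u := d) (w := d) (by omega) le_rfl (by omega)
      fun i => ?_).trans (by omega)
    simp only [p, p', hrev]; omega
  have g21 : finrank F (V.space 2 ⊓ V'.space 1 : Submodule F _) = c := by
    rw [o]
    change finrank F (_ ⊓ coordSubmodule F d p' : Submodule F _) = c
    rw [coordSubmodule_inf]
    refine (finrank_coordSubmodule_of_iff (c := c) (u := d) (w := d) (by omega) le_rfl (by omega)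
      fun i => ?_).trans (by omega)
    simp only [p, p', hrev]; omega
  have g22 : finrank F (V.space 2 ⊓ V'.space 2 : Submodule F _) = c + 1 := by
    rw [o, o', coordSubmodule_inf]
    refine (finrank_coordSubmodule_of_iff (c := c) (u := d) (w := d + 1) (by omega) (by omega)
      (by omega) fun i => ?_).trans (by omega)
    simp only [p, p', hrev]; omega
  refine ⟨V, V', ?_⟩
  clear_value V V'
  apply relPos_of_finrank <;> simp [Fin.sum_univ_three, Amat, *] <;> omega

end Flags

/-! ### Structure constants -/

/-- Nonemptiness of the orbit over `ZMod l` pins the value at every odd prime `l`, and these are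
infinitely many points. -/
theorem IsStructPoly.unique {n d : ℕ} {A B C : Xi n d}
    (hC : ∀ (F : Type) [Field F], ∃ V V' : IsoFlag F n d, RelPos C.1 V V')
    {p p' : Polynomial ℤ} (h : IsStructPoly A B C p) (h' : IsStructPoly A B C p') : p = p' := by
  refine Polynomial.eq_of_infinite_eval_eq p p' ?_
  have hinf : ({l : ℕ | l.Prime} \ {2}).Infinite :=
    Nat.infinite_setOfPred_prime.sdiff (Set.finite_singleton 2)
  refine (hinf.image (f := (Nat.cast : ℕ → ℤ)) Nat.cast_injective.injOn).mono ?_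
  rintro _ ⟨l, ⟨hl, hl2⟩, rfl⟩
  have : Fact l.Prime := ⟨hl⟩
  obtain ⟨V, V', hV⟩ := hC (ZMod l)
  have hodd : Odd (Fintype.card (ZMod l)) := by
    rw [ZMod.card]; exact hl.odd_of_ne_two hl2
  have e := (h (ZMod l) hodd V V' hV).trans (h' (ZMod l) hodd V V' hV).symm
  rwa [ZMod.card] at e

theorem structPoly_eq {n d : ℕ} {A B C : Xi n d}
    (hC : ∀ (F : Type) [Field F], ∃ V V' : IsoFlag F n d, RelPos C.1 V V')
    {p : Polynomial ℤ} (h : IsStructPoly A B C p) : structPoly A B C = p := by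
  have hu : ∃! p : Polynomial ℤ, IsStructPoly A B C p := ⟨p, h, fun _ h' => h'.unique hC h⟩
  rw [structPoly, dif_pos hu]
  exact hu.choose_spec.1.unique hC h

/-- Nonemptiness of the orbit of `C` is not needed here: if uniqueness fails, the default value of
`structPoly` is `0` as well. -/
theorem structPoly_eq_zero {n d : ℕ} {A B C : Xi n d} (h : IsStructPoly A B C 0) :
    structPoly A B C = 0 := by
  unfold structPoly
  split_ifs with hu
  · exact hu.unique hu.choose_spec.1 h
  · rfl

theorem Xmat_mem {d a r : ℕ} (h : a + r = d) : Xmat a r ∈ XiSet 3 d := by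
  refine ⟨?_, ?_⟩
  · simp [Xmat, Fin.sum_univ_three]; omega
  · intro i j; fin_cases i <;> fin_cases j <;> rfl

theorem Ymat_mem {d a r : ℕ} (h : a + r = d) : Ymat a r ∈ XiSet 3 d := by
  refine ⟨?_, ?_⟩
  · simp [Ymat, Fin.sum_univ_three]; omega
  · intro i j; fin_cases i <;> fin_cases j <;> rfl

theorem structPoly_Amat {d a r c s : ℕ} (h : a + r = d) (h' : c + s = d)
    (hC : Amat c s ∈ XiSet 3 d) :
    structPoly ⟨Xmat a r, Xmat_mem h⟩ ⟨Ymat a r, Ymat_mem h⟩ ⟨Amat c s, hC⟩ = gaussBinom c a := by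
  refine structPoly_eq (fun F _ => exists_relPos_Amat F h') ?_
  intro F _ _ _ V V' hV
  have h1 := hV.finrank_left 1
  have h2 := hV.finrank_right 1
  have h3 := hV 1 1
  simp [Amat, Fin.sum_univ_three] at h1 h2 h3
  rw [card_relPos_Xmat_Ymat h (h1.trans h') (h2.trans h'), h3]

/-- By symmetry the outer rows both have sum `d`, which leaves `1 = 2 C_{10} + C_{11}` for the
middle row. Hence `C_{10} = 0` and `C_{11} = 1`; the same applies to the middle column. -/
theorem eq_Amat_of_mem {d : ℕ} {C : Matrix (Fin 3) (Fin 3) ℕ} (hC : C ∈ XiSet 3 d)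
    (hrow : C 0 0 + C 0 1 + C 0 2 = d) (hcol : C 0 0 + C 1 0 + C 2 0 = d) :
    C 0 0 + C 0 2 = d ∧ C = Amat (C 0 0) (C 0 2) := by
  obtain ⟨hs, hC⟩ := hC
  have c1 : C 0 0 = C 2 2 := hC 0 0
  have c2 : C 0 1 = C 2 1 := hC 0 1
  have c3 : C 0 2 = C 2 0 := hC 0 2
  have c4 : C 1 0 = C 1 2 := hC 1 0
  simp only [Fin.sum_univ_three] at hs
  refine ⟨by omega, ?_⟩
  ext i j
  fin_cases i <;> fin_cases j <;> simp [Amat] <;> omega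

theorem structPoly_of_ne_Amat {d a r : ℕ} (h : a + r = d) (C : Xi 3 d)
    (hC : ∀ c s : ℕ, c + s = d → C.1 ≠ Amat c s) :
    structPoly ⟨Xmat a r, Xmat_mem h⟩ ⟨Ymat a r, Ymat_mem h⟩ C = 0 := by
  refine structPoly_eq_zero ?_
  intro F _ _ _ V V' hV
  rw [Polynomial.eval_zero, eq_comm, Nat.cast_eq_zero, Nat.card_eq_zero]
  refine Or.inl ⟨fun W => ?_⟩
  have h1 := hV.finrank_left 1
  have h2 := hV.finrank_right 1
  simp [Fin.sum_univ_three] at h1 h2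
  rw [((relPos_Xmat h).mp W.2.1).1] at h1
  rw [((relPos_Ymat h).mp W.2.2).1] at h2
  obtain ⟨h3, h4⟩ := eq_Amat_of_mem C.2 h1.symm h2.symm
  exact hC _ _ h3 h4

/-! ### The monomials in the standard basis -/

theorem fibreDim_Xmat (a r : ℕ) : fibreDim (Xmat a r) = a * r := by
  simp [fibreDim, Xmat, Fin.sum_univ_three]
  ring_nf
  omega

theorem two_mul_fibreDim_Ymat (a r : ℕ) : 2 * (fibreDim (Ymat a r) : ℤ) = r * (r + 1) := by
  have h : fibreDim (Ymat a r) = (r + 1).choose 2 := by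
    rw [Nat.choose_two_right, Nat.add_sub_cancel]
    simp [fibreDim, Ymat, Fin.sum_univ_three]
    congr 1
    ring_nf
  rw [h, two_mul_choose_succ_two]

theorem two_mul_fibreDim_Amat (a r : ℕ) :
    2 * (fibreDim (Amat a r) : ℤ) = 2 * a * r + r * (r + 1) := by
  have h : fibreDim (Amat a r) = (2 * (a * r) + (r + 1) * r) / 2 := by
    simp [fibreDim, Amat, Fin.sum_univ_three]
    congr 1
    ring_nf
    omega
  rw [h, Nat.mul_add_div (by norm_num), ← show (r + 1).choose 2 = (r + 1) * r / 2 by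
    rw [Nat.choose_two_right, Nat.add_sub_cancel]]
  have := two_mul_choose_succ_two r
  push_cast at this ⊢
  linarith

theorem JSchur.sum_apply {n d : ℕ} {ι : Type*} (s : Finset ι) (f : ι → JSchur n d) (C : Xi n d) :
    (∑ i ∈ s, f i) C = ∑ i ∈ s, f i C :=
  Finset.sum_apply C s (fun i => (f i : Xi n d → Qv))

theorem JSchur.smul_apply {n d : ℕ} (c : Qv) (x : JSchur n d) (C : Xi n d) :
    (c • x) C = c * x C := rfl

theorem std_apply_self {n d : ℕ} (A : Xi n d) : std d A.1 A = vv ^ (-(fibreDim A.1 : ℤ)) :=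
  if_pos rfl

theorem std_apply_of_ne {n d : ℕ} {A : Matrix (Fin n) (Fin n) ℕ} {B : Xi n d} (h : B.1 ≠ A) :
    std d A B = 0 := if_neg h

theorem std_mul_std_apply {n d : ℕ} (A B C : Xi n d) :
    (std d A.1 * std d B.1) C =
      vv ^ (-(fibreDim A.1 : ℤ)) * vv ^ (-(fibreDim B.1 : ℤ)) *
        Polynomial.aeval (vv ^ 2) (structPoly A B C) := by
  change ∑ A' : Xi n d, ∑ B' : Xi n d,
    std d A.1 A' * std d B.1 B' * Polynomial.aeval (vv ^ 2) (structPoly A' B' C) = _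
  rw [Finset.sum_eq_single A, Finset.sum_eq_single B, std_apply_self, std_apply_self]
  · intro B' _ hB
    rw [std_apply_of_ne (fun h => hB (Subtype.ext h)), mul_zero, zero_mul]
  · exact fun h => absurd (Finset.mem_univ _) h
  · intro A' _ hA
    refine Finset.sum_eq_zero fun B' _ => ?_
    rw [std_apply_of_ne (fun h => hA (Subtype.ext h)), zero_mul, zero_mul]
  · exact fun h => absurd (Finset.mem_univ _) h

theorem Amat_inj {a b a' b' : ℕ} : Amat a b = Amat a' b' ↔ a = a' ∧ b = b' := by
  refine ⟨fun h => ⟨congrFun (congrFun h 0) 0, congrFun (congrFun h 0) 2⟩, ?_⟩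
  rintro ⟨rfl, rfl⟩
  rfl

theorem monoM_eq_sum {d a r : ℕ} (h : a + r = d) :
    monoM d a r = ∑ j ∈ Finset.range (r + 1), monoCoeff a j • std d (Amat (a + j) (r - j)) := by
  have hv := vv_ne_zero
  funext C
  have hl := std_mul_std_apply ⟨Xmat a r, Xmat_mem h⟩ ⟨Ymat a r, Ymat_mem h⟩ C
  change monoM d a r C = _ at hl
  rw [hl, JSchur.sum_apply]
  by_cases hC : ∀ c s : ℕ, c + s = d → C.1 ≠ Amat c s
  · rw [structPoly_of_ne_Amat h C hC, map_zero, mul_zero]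
    refine (Finset.sum_eq_zero fun j hj => ?_).symm
    rw [Finset.mem_range] at hj
    rw [JSchur.smul_apply, std_apply_of_ne (hC _ _ (by omega)), mul_zero]
  push Not at hC
  obtain ⟨c, s, hcs, hC⟩ := hC
  obtain ⟨C, hCm⟩ := C
  subst hC
  rw [structPoly_Amat h hcs]
  rcases lt_or_ge c a with hca | hca
  · rw [gaussBinom_eq_zero hca, map_zero, mul_zero]
    refine (Finset.sum_eq_zero fun j hj => ?_).symm
    rw [JSchur.smul_apply, std_apply_of_ne, mul_zero]
    intro e
    rw [Amat_inj] at e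
    omega
  obtain ⟨j, rfl⟩ := Nat.exists_eq_add_of_le hca
  obtain rfl : s = r - j := by omega
  rw [Finset.sum_eq_single j]
  · rw [JSchur.smul_apply, std_apply_self ⟨Amat (a + j) (r - j), hCm⟩, monoCoeff, ← zpow_add₀ hv,
      mul_right_comm, ← zpow_add₀ hv]
    -- With `r = j + s` the exponent is `-δ(X) - δ(Y) + δ(A_{a+j,s}) = -aj - j(j+1)/2`; the
    -- relations are doubled to avoid division.
    congr 2
    obtain ⟨s, rfl⟩ := Nat.exists_eq_add_of_le (show j ≤ r by omega)
    have h1 := fibreDim_Xmat a (j + s)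
    have h2 := two_mul_fibreDim_Ymat a (j + s)
    have h3 := two_mul_fibreDim_Amat (a + j) s
    have h4 := two_mul_choose_succ_two j
    dsimp only
    rw [Nat.add_sub_cancel_left]
    zify at h1
    push_cast at h1 h2 h3
    simp only [h1]
    linarith
  · intro i _ hi
    rw [JSchur.smul_apply, std_apply_of_ne, mul_zero]
    intro e
    rw [Amat_inj] at e
    omega
  · intro hj
    rw [Finset.mem_range] at hj
    omega

/-! ### The standard basis and the monomial basis of the subalgebra -/

/-- `[A_{c,d-c}]`, and `0` for `c > d`. -/
def stdI (d c : ℕ) : ISchur 2 d :=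
  if h : c ≤ d then stdA d c (d - c) (Nat.add_sub_cancel' h) else 0

theorem stdA_eq_stdI {d a r : ℕ} (h : a + r = d) : stdA d a r h = stdI d a := by
  obtain rfl : r = d - a := by omega
  rw [stdI, dif_pos (by omega)]

theorem coe_stdI {d c : ℕ} (h : c ≤ d) : (stdI d c : JSchur 3 d) = std d (Amat c (d - c)) := by
  rw [stdI, dif_pos h]
  rfl

/-- The coefficient of `[A_{c,d-c}]`. -/
def coordI (d : ℕ) (c : Fin (d + 1)) : ISchur 2 d →ₗ[Qv] Qv where
  toFun x := vv ^ (fibreDim (Amat c (d - c)) : ℤ) *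
    (x : JSchur 3 d) ⟨Amat c (d - c), by
      have := (Amat_mem c (d - c)).1
      rwa [Nat.add_sub_cancel' (Nat.lt_succ_iff.mp c.2)] at this⟩
  map_add' x y := mul_add _ _ _
  map_smul' k x := mul_left_comm _ _ _

theorem coordI_stdI {d : ℕ} (c : Fin (d + 1)) {c' : ℕ} (h : c' ≤ d) :
    coordI d c (stdI d c') = if c.val = c' then 1 else 0 := by
  change _ * (stdI d c' : JSchur 3 d) _ = _
  rw [coe_stdI h]
  split_ifs with e
  · subst e
    refine (congrArg _ (std_apply_self (⟨Amat c (d - c), _⟩ : Xi 3 d))).trans ?_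
    rw [← zpow_add₀ vv_ne_zero]
    simp
  · rw [std_apply_of_ne, mul_zero]
    intro e'
    exact e (Amat_inj.mp e').1

theorem span_stdI (d : ℕ) : Submodule.span Qv {x | ∃ c ≤ d, x = stdI d c} = ⊤ := by
  refine eq_top_iff.mpr ((Submodule.span_span_coe_preimage (R := Qv)
    (s := {x : JSchur 3 d | ∃ A ∈ XiISet 3 d, x = std d A})).ge.trans (Submodule.span_mono ?_))
  rintro ⟨_, hx⟩ ⟨A, ⟨hA, hA'⟩, rfl⟩
  have hm := hA' 1 rfl
  have h01 : A 0 1 = 0 := (hm 0).2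
  have h10 : A 1 0 = 0 := (hm 0).1
  have h11 : A 1 1 = 1 := (hm 1).1
  have h12 : A 1 2 = 0 := (hm 2).1
  have h21 : A 2 1 = 0 := (hm 2).2
  have h00 : A 0 0 = A 2 2 := hA.2 0 0
  have h02 : A 0 2 = A 2 0 := hA.2 0 2
  have hs := hA.1
  simp only [Fin.sum_univ_three] at hs
  obtain ⟨h1, h2⟩ := eq_Amat_of_mem hA (by omega) (by omega)
  refine ⟨A 0 0, by omega, Subtype.ext ?_⟩
  rw [coe_stdI (by omega)]
  have h3 : d - A 0 0 = A 0 2 := by omega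
  rw [h3]
  exact congrArg (std d) h2

/-- `M_{c,d-c}` as an element of the subalgebra. -/
def monoI (d c : ℕ) : ISchur 2 d :=
  ∑ j ∈ Finset.range (d - c + 1), monoCoeff c j • stdI d (c + j)

theorem coe_monoI {d a r : ℕ} (h : a + r = d) : (monoI d a : JSchur 3 d) = monoM d a r := by
  obtain rfl : r = d - a := by omega
  rw [monoM_eq_sum h, monoI, AddSubmonoidClass.coe_finsetSum]
  refine Finset.sum_congr rfl fun j hj => ?_
  rw [Finset.mem_range] at hj
  rw [Submodule.coe_smul, coe_stdI (by omega), Nat.sub_add_eq]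

/-- The expansion of `monoI d c` is `stdI d c` plus terms of larger index, so it is inverted by
induction on `d - c`. -/
theorem span_monoI (d : ℕ) : Submodule.span Qv {x | ∃ c ≤ d, x = monoI d c} = ⊤ := by
  rw [eq_top_iff, ← span_stdI, Submodule.span_le]
  rintro _ ⟨c, hc, rfl⟩
  induction hn : d - c using Nat.strong_induction_on generalizing c with
  | _ n ih =>
    have h : stdI d c = monoI d c -
        ∑ j ∈ Finset.range (d - c), monoCoeff c (j + 1) • stdI d (c + (j + 1)) := by
      rw [monoI, Finset.sum_range_succ', monoCoeff_zero, one_smul, add_zero, add_sub_cancel_left]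
    rw [h]
    refine Submodule.sub_mem _ (Submodule.subset_span ⟨c, hc, rfl⟩) ?_
    refine Submodule.sum_mem _ fun j hj => Submodule.smul_mem _ _ ?_
    rw [Finset.mem_range] at hj
    exact ih (d - (c + (j + 1))) (by omega) (c + (j + 1)) (by omega) rfl

/-! ### The bar involution -/

/-- The bar conjugate of `[A_{c,d-c}]`. -/
def barStd (d c : ℕ) : ISchur 2 d :=
  ∑ i ∈ Finset.range (d - c + 1), barCoeff c i • stdI d (c + i)

/-- The bar involution. -/
def barI (d : ℕ) : ISchur 2 d →ₛₗ[conjQv] ISchur 2 d where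
  toFun x := ∑ c : Fin (d + 1), conjQv (coordI d c x) • barStd d c
  map_add' x y := by simp only [map_add, add_smul, Finset.sum_add_distrib]
  map_smul' k x := by simp only [map_smul, smul_eq_mul, map_mul, mul_smul, Finset.smul_sum]

theorem barI_stdI {d c : ℕ} (h : c ≤ d) : barI d (stdI d c) = barStd d c := by
  change ∑ c' : Fin (d + 1), conjQv (coordI d c' (stdI d c)) • barStd d c' = _
  rw [Finset.sum_eq_single ⟨c, Nat.lt_succ_iff.mpr h⟩]
  · rw [coordI_stdI _ h, if_pos rfl, map_one, one_smul]
  · intro c' _ hc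
    rw [coordI_stdI _ h, if_neg (fun e => hc (Fin.ext e)), map_zero, zero_smul]
  · exact fun h => absurd (Finset.mem_univ _) h

theorem barI_monoI {d c : ℕ} (h : c ≤ d) : barI d (monoI d c) = monoI d c := by
  have h1 : barI d (monoI d c) = ∑ j ∈ Finset.range (d - c + 1),
      ∑ i ∈ Finset.range (d - c + 1 - j),
        (conjQv (monoCoeff c j) * barCoeff (c + j) i) • stdI d (c + j + i) := by
    rw [monoI, map_sum]
    refine Finset.sum_congr rfl fun j hj => ?_
    rw [Finset.mem_range] at hj
    rw [map_smulₛₗ, barI_stdI (by omega), barStd, Finset.smul_sum,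
      show d - (c + j) + 1 = d - c + 1 - j by omega]
    simp only [mul_smul]
  -- Regrouping by `n = j + i` makes the coefficient of `stdI d (c + n)` the sum in
  -- `sum_conjQv_monoCoeff_mul_barCoeff`.
  rw [h1, ← Finset.sum_range_diag_flip (d - c + 1) fun j i =>
    (conjQv (monoCoeff c j) * barCoeff (c + j) i) • stdI d (c + j + i), monoI]
  refine Finset.sum_congr rfl fun n _ => ?_
  rw [← sum_conjQv_monoCoeff_mul_barCoeff, Finset.sum_smul]
  refine Finset.sum_congr rfl fun j hj => ?_
  rw [Finset.mem_range] at hj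
  rw [add_assoc, Nat.add_sub_cancel' (by omega)]

/-- The square is linear because `conjQv` is an involution, and it fixes the spanning monomials. The
explicit formula never has to be iterated. -/
theorem barI_barI {d : ℕ} (x : ISchur 2 d) : barI d (barI d x) = x := by
  have hx : x ∈ Submodule.span Qv {x | ∃ c ≤ d, x = monoI d c} := by
    rw [span_monoI]; trivial
  induction hx using Submodule.span_induction with
  | mem x hx =>
    obtain ⟨c, hc, rfl⟩ := hx
    rw [barI_monoI hc, barI_monoI hc]
  | zero => rw [map_zero, map_zero]
  | add x y _ _ hx hy => rw [map_add, map_add, hx, hy]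
  | smul k x _ hx => rw [map_smulₛₗ, map_smulₛₗ, hx, conjQv_conjQv]

theorem isIBar_barI (d : ℕ) : IsIBar d (barI d) where
  invol := barI_barI
  fixes a r h := ⟨monoI d a, coe_monoI h, barI_monoI (by omega)⟩

theorem IsIBar.apply_monoI {d : ℕ} {β : ISchur 2 d →ₛₗ[conjQv] ISchur 2 d} (hβ : IsIBar d β)
    {c : ℕ} (hc : c ≤ d) : β (monoI d c) = monoI d c := by
  obtain ⟨m, hm, hβm⟩ := hβ.fixes c (d - c) (Nat.add_sub_cancel' hc)
  rw [← coe_monoI (Nat.add_sub_cancel' hc)] at hm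
  rwa [Subtype.ext hm] at hβm

theorem IsIBar.eq_barI {d : ℕ} {β : ISchur 2 d →ₛₗ[conjQv] ISchur 2 d} (hβ : IsIBar d β) :
    β = barI d := by
  refine LinearMap.ext_on (span_monoI d) ?_
  rintro _ ⟨c, hc, rfl⟩
  rw [hβ.apply_monoI hc, barI_monoI hc]

/-! ### Comparison with bar involutions of `S^ȷ(3,d)`. -/

theorem isChevalley_Xmat (a r : ℕ) : IsChevalley (Xmat a r) := by
  refine Or.inr ⟨0, 1, r, ![a, 1, a], rfl, fun k l => ?_⟩
  fin_cases k <;> fin_cases l <;> simp [Xmat, Etheta, Fin.ext_iff]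

theorem isChevalley_Ymat (a r : ℕ) : IsChevalley (Ymat a r) := by
  -- For `n = 3` one has `E^θ_{2,1} = E^θ_{2,3}`, so the superdiagonal index pair `(1, 2)`, counted
  -- from `0`, serves for `Y`.
  refine Or.inr ⟨1, 2, r, ![a, 1, a], rfl, fun k l => ?_⟩
  fin_cases k <;> fin_cases l <;> simp [Ymat, Etheta, Fin.ext_iff]

theorem IsJBar.apply_monoM {d : ℕ} {β : JSchur 3 d →ₛₗ[conjQv] JSchur 3 d} (hβ : IsJBar 3 d β)
    {a r : ℕ} (h : a + r = d) : β (monoM d a r) = monoM d a r := by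
  change β (std d (Xmat a r) * std d (Ymat a r)) = std d (Xmat a r) * std d (Ymat a r)
  rw [hβ.map_mul, hβ.fixes _ (Xmat_mem h) (isChevalley_Xmat a r),
    hβ.fixes _ (Ymat_mem h) (isChevalley_Ymat a r)]

theorem IsJBar.apply_coe {d : ℕ} {β : JSchur 3 d →ₛₗ[conjQv] JSchur 3 d} (hβ : IsJBar 3 d β)
    (x : ISchur 2 d) : β (x : JSchur 3 d) = (barI d x : JSchur 3 d) := by
  have h : β.comp (ISchur 2 d).subtype = (ISchur 2 d).subtype.comp (barI d) := by
    refine LinearMap.ext_on (span_monoI d) ?_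
    rintro _ ⟨c, hc, rfl⟩
    change β (monoI d c : JSchur 3 d) = (barI d (monoI d c) : JSchur 3 d)
    rw [barI_monoI hc, coe_monoI (Nat.add_sub_cancel' hc),
      hβ.apply_monoM (Nat.add_sub_cancel' hc)]
  exact LinearMap.congr_fun h x

theorem barI_stdA {d a r : ℕ} (h : a + r = d) :
    barI d (stdA d a r h) =
      ∑ i : Fin (r + 1), barCoeff a i • stdI d (a + i.val) := by
  obtain rfl : r = d - a := by omega
  rw [stdA_eq_stdI, barI_stdI (by omega), barStd, Finset.sum_range]

end

theorem mainTheorem7 (d : ℕ) :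
    (∃! bar : ISchur 2 d →ₛₗ[conjQv] ISchur 2 d, IsIBar d bar) ∧
    ∀ bar : ISchur 2 d →ₛₗ[conjQv] ISchur 2 d, IsIBar d bar →
      (∀ β : JSchur 3 d →ₛₗ[conjQv] JSchur 3 d, IsJBar 3 d β →
        ∀ x : ISchur 2 d, β (x : JSchur 3 d) = (bar x : JSchur 3 d)) ∧
      ∀ (a r : ℕ) (h : a + r = d),
        bar (stdA d a r h) =
          ∑ i : Fin (r + 1),
            (vv ^ (-((i.val : ℤ) * a) - ((i.val + 1).choose 2 : ℤ)) *
              ((∏ k ∈ Finset.Icc 1 i.val, (1 - vv ^ (2 * (a + k)))) /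
                ∏ k ∈ Finset.Icc 1 (i.val / 2), (1 - vv ^ (4 * k)))) •
              stdA d (a + i.val) (r - i.val) (by omega) ∧
        bar (stdA d a r h) =
          ∑ i : Fin (r + 1),
            ((∏ k ∈ Finset.Icc 1 i.val, (vv ^ (-(a : ℤ) - (k : ℤ)) - vv ^ (a + k))) /
                ∏ k ∈ Finset.Icc 1 (i.val / 2), (1 - vv ^ (4 * k))) •
              stdA d (a + i.val) (r - i.val) (by omega) := by
  refine ⟨⟨barI d, isIBar_barI d, fun β hβ => hβ.eq_barI⟩, fun bar hbar => ?_⟩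
  rw [hbar.eq_barI]
  refine ⟨fun β hβ x => hβ.apply_coe x, fun a r h => ?_⟩
  simp only [stdA_eq_stdI]
  rw [← stdA_eq_stdI h, barI_stdA h]
  refine ⟨Finset.sum_congr rfl fun i _ => ?_, rfl⟩
  rw [barCoeff, prod_sub_eq, mul_div_assoc]
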